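/- Consider $N$ parallel queues with service rates $\mu_1,\dots,\mu_N>0$ and arrival rate $\Xi>0$. Let $S_t\in\mathbb{Z}_{\ge 0}^N$ be the occupation vector seen by the $t$-th arrival ($t=0,1,2,\dots$) and $A_t\in\{1,\dots,N\}$ the queue to which this arrival is sent. Given the past, $S_{t+1}$ has the law $$p(s'\mid s,i)=\widehat p_i(s_i-s_i'+1;\,s_i)\prod_{j\ne i}\widehat p_j(s_j-s_j';\,s_j)\qquad\text{on }\{S_t=s,\ A_t=i\},$$ where $$\widehat p_j(u;n)=\Xi\int_0^\infty\binom{n}{u}e^{-\mu_j t(n-u)}(1-e^{-\mu_j t})^u e^{-\Xi t}\,dt\quad\text{for } 0\le u\le n,$$ and $\widehat p_j(u;n)=0$ otherwise. Queues $1,\dots,M$ ($M\le N$) are constrained, with capacities $\theta_1,\dots,\theta_M\in\mathbb{R}$, and the others are not. Assume that the constraints can be met, i.e. that there is a probability vector $(p_1,\dots,p_N)$ with $p_i\le\theta_i$ for all $i\le M$. For an integer $k\ge 0$, the policy JSED-$k$ is the following. At time $t$, call a queue *eligible* if it is unconstrained, or if it is a constrained queue $i$ that occurs at most $k\theta_i$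 times among the last $k$ actions $A_{t-k},\dots,A_{t-1}$ (among all past actions if $t<k$). The policy sends the arrival to an eligible queue that minimizes $S_{t,i}/\mu_i$ over the eligible queues $i$. Ties are broken by any fixed rule, possibly randomized, that depends only on the current state and the remembered actions. For an initial distribution $\beta$ of $S_0$, let $F_i=\limsup_{T\to\infty}\frac1T\sum_{t=0}^{T}\mathbf 1\{A_t=i\}$ be the long-run access frequency of queue $i$, and let $K^i_{\pi}(\beta)=\mathbb{E}_{\pi,\,S_0\sim\beta}[F_i]$ be its average access cost under the policy $\pi$. **Proposition.** JSED-$k$ is safe for sufficiently large $k$, in the following sense. For every $\varepsilon>0$ there is a $k_0$ such that for every $k\ge k_0$, every JSED-$k$ policy $\pi_k$, every initial distribution $\beta$ and every constrained queue $i\le M$: almost surely $F_i\le\theta_i+\varepsilon$, the random variable $F_i$ is integrable, and $K^i_{\pi_k}(\beta)\le\theta_i+\varepsilon$. -/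

import Mathlib

open MeasureTheory ProbabilityTheory Filter

namespace LoadBalancing

/-- A system of `N` parallel queues; the queues with index `i < M` are the constrained ones.
`Ξ` is the arrival rate, `μ i` the service rate of queue `i`, and `θ i` (read only for `i < M`) the
largest fraction of the arrivals that may be routed to queue `i`. -/
structure System (N M : ℕ) where
  Ξ : ℝ
  μ : Fin N → ℝ
  θ : Fin N → ℝ
  Ξ_pos : 0 < Ξ
  μ_pos : ∀ i, 0 < μ i
  M_le : M ≤ N

/-- Occupation vectors. -/
abbrev State (N : ℕ) := Fin N → ℕ

variable {N M : ℕ}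

/-- The access constraint can be met: some splitting of the arrivals among the queues respects
it. -/
def System.Feasible (Q : System N M) : Prop :=
  ∃ p : Fin N → ℝ, (∀ i, 0 ≤ p i) ∧ ∑ i, p i = 1 ∧ ∀ i : Fin N, (i : ℕ) < M → p i ≤ Q.θ i

/-- The probability that `u` customers leave queue `j` between two arrivals, when `n` are present
at the beginning of the inter-arrival interval. -/
noncomputable def System.departProb (Q : System N M) (j : Fin N) (u : ℤ) (n : ℕ) : ℝ :=
  if 0 ≤ u ∧ u ≤ n then
    Q.Ξ * ∫ t in Set.Ioi (0 : ℝ), (n.choose u.toNat : ℝ) * Real.exp (-Q.μ j * t * (n - u)) *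
      (1 - Real.exp (-Q.μ j * t)) ^ u.toNat * Real.exp (-Q.Ξ * t)
  else 0

/-- The transition probability `p(s' | s, i)`: one customer joins queue `i`, and the queues
have independent numbers of departures. -/
noncomputable def System.transProb (Q : System N M) (s : State N) (i : Fin N) (s' : State N) : ℝ :=
  ∏ j, Q.departProb j (if j = i then (s j : ℤ) - s' j + 1 else (s j : ℤ) - s' j) (s j)

theorem System.departProb_nonneg (Q : System N M) (j : Fin N) (u : ℤ) (n : ℕ) :
    0 ≤ Q.departProb j u n := by
  unfold System.departProb
  split_ifs
  · refine mul_nonneg Q.Ξ_pos.le (setIntegral_nonneg measurableSet_Ioi fun t ht => ?_)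
    have ht : 0 < t := ht
    have h : Real.exp (-Q.μ j * t) ≤ 1 := by
      rw [Real.exp_le_one_iff]
      nlinarith [mul_pos (Q.μ_pos j) ht]
    have h' := sub_nonneg.2 h
    positivity
  · exact le_rfl

theorem System.sum_departProb (Q : System N M) (j : Fin N) (n : ℕ) :
    ∑ u ∈ Finset.range (n + 1), Q.departProb j (u : ℤ) n = 1 := by
  have hint : ∀ u ∈ Finset.range (n + 1), IntegrableOn (fun t : ℝ => (n.choose u : ℝ) *
      Real.exp (-Q.μ j * t * (n - u)) * (1 - Real.exp (-Q.μ j * t)) ^ u * Real.exp (-Q.Ξ * t))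
      (Set.Ioi 0) := by
    intro u hu
    have hu : (u : ℝ) ≤ n := by
      exact_mod_cast Nat.lt_succ_iff.1 (Finset.mem_range.1 hu)
    refine Integrable.mono' ((exp_neg_integrableOn_Ioi 0 Q.Ξ_pos).const_mul (n.choose u : ℝ))
      (by fun_prop) ?_
    refine (ae_restrict_iff' measurableSet_Ioi).2 (ae_of_all _ fun t ht => ?_)
    have ht : 0 < t := ht
    have hm := mul_pos (Q.μ_pos j) ht
    have h0 : Real.exp (-Q.μ j * t) ≤ 1 := by
      rw [Real.exp_le_one_iff]; nlinarith
    have h1 : Real.exp (-Q.μ j * t * (n - u)) ≤ 1 := by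
      rw [Real.exp_le_one_iff]; nlinarith
    have h2 : (1 - Real.exp (-Q.μ j * t)) ^ u ≤ 1 :=
      pow_le_one₀ (sub_nonneg.2 h0) (by linarith [Real.exp_pos (-Q.μ j * t)])
    have h3 := sub_nonneg.2 h0
    rw [Real.norm_of_nonneg (by positivity)]
    refine mul_le_mul_of_nonneg_right ?_ (Real.exp_pos _).le
    calc _ ≤ (n.choose u : ℝ) * 1 * 1 := by gcongr
      _ = _ := by ring
  have h : ∀ u ∈ Finset.range (n + 1), Q.departProb j (u : ℤ) n =
      Q.Ξ * ∫ t in Set.Ioi (0 : ℝ), (n.choose u : ℝ) * Real.exp (-Q.μ j * t * (n - u)) *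
        (1 - Real.exp (-Q.μ j * t)) ^ u * Real.exp (-Q.Ξ * t) := by
    intro u hu
    have hu := Nat.lt_succ_iff.1 (Finset.mem_range.1 hu)
    rw [System.departProb, if_pos ⟨by positivity, by exact_mod_cast hu⟩]
    simp
  rw [Finset.sum_congr rfl h, ← Finset.mul_sum, ← integral_finsetSum _ hint]
  have h' : ∀ t : ℝ, ∑ u ∈ Finset.range (n + 1), (n.choose u : ℝ) *
      Real.exp (-Q.μ j * t * (n - u)) * (1 - Real.exp (-Q.μ j * t)) ^ u * Real.exp (-Q.Ξ * t) =
      Real.exp (-Q.Ξ * t) := by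
    intro t
    have hb := add_pow (1 - Real.exp (-Q.μ j * t)) (Real.exp (-Q.μ j * t)) n
    rw [sub_add_cancel, one_pow] at hb
    rw [← Finset.sum_mul]
    conv_rhs => rw [← one_mul (Real.exp (-Q.Ξ * t)), hb]
    congr 1
    refine Finset.sum_congr rfl fun u hu => ?_
    have hu := Nat.lt_succ_iff.1 (Finset.mem_range.1 hu)
    rw [← Real.exp_nat_mul, Nat.cast_sub hu]
    ring_nf
  simp_rw [h']
  rw [integral_exp_mul_Ioi (neg_lt_zero.2 Q.Ξ_pos)]
  have := Q.Ξ_pos.ne'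
  simp
  field_simp

theorem System.sum_transProb (Q : System N M) (s : State N) (i : Fin N) :
    ∑ s' ∈ Fintype.piFinset fun j => Finset.range (s j + 2),
      ENNReal.ofReal (Q.transProb s i s') = 1 := by
  rw [← ENNReal.ofReal_sum_of_nonneg (f := fun s' => Q.transProb s i s') fun s' _ =>
    Finset.prod_nonneg fun j _ => Q.departProb_nonneg j _ _]
  unfold System.transProb
  rw [← Finset.prod_univ_sum (fun j => Finset.range (s j + 2)) fun j x =>
    Q.departProb j (if j = i then (s j : ℤ) - x + 1 else (s j : ℤ) - x) (s j)]
  rw [Finset.prod_eq_one, ENNReal.ofReal_one]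
  intro j _
  rw [← Q.sum_departProb j (s j)]
  by_cases hj : j = i
  · simp only [hj, if_true]
    rw [Finset.sum_range_succ', ← Finset.sum_range_reflect]
    rw [show Q.departProb i ((s i : ℤ) - (0 : ℕ) + 1) (s i) = 0 from if_neg (by simp), add_zero]
    refine Finset.sum_congr rfl fun u hu => ?_
    have hu := Finset.mem_range.1 hu
    congr 1
    omega
  · simp only [hj, if_false]
    rw [Finset.sum_range_succ, ← Finset.sum_range_reflect]
    rw [show Q.departProb j ((s j : ℤ) - (s j + 1 : ℕ)) (s j) = 0 from if_neg (by simp), add_zero]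
    refine Finset.sum_congr rfl fun u hu => ?_
    have hu := Finset.mem_range.1 hu
    congr 1
    omega

theorem System.transProb_eq_zero (Q : System N M) (s : State N) (i : Fin N) (s' : State N)
    (hs : s' ∉ Fintype.piFinset fun j => Finset.range (s j + 2)) :
    ENNReal.ofReal (Q.transProb s i s') = 0 := by
  simp only [Fintype.mem_piFinset, Finset.mem_range, not_forall, not_lt] at hs
  obtain ⟨j, hj⟩ := hs
  rw [System.transProb, Finset.prod_eq_zero (Finset.mem_univ j), ENNReal.ofReal_zero]
  refine if_neg ?_
  split_ifs <;> omega

/-- The law `p(· | s, i)` of the next state. -/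
noncomputable def System.nextState (Q : System N M) (s : State N) (i : Fin N) : PMF (State N) :=
  PMF.ofFinset (fun s' => ENNReal.ofReal (Q.transProb s i s'))
    (Fintype.piFinset fun j => Finset.range (s j + 2)) (Q.sum_transProb s i)
    (Q.transProb_eq_zero s i)

/-- A (possibly randomized) policy with memory: it maps the current state and the list of the
remembered past actions to a law on the queues. -/
abbrev MemoryPolicy (N : ℕ) := State N → List (Fin N) → PMF (Fin N)

/-- Given the states and actions at times `0, …, n`, the list of the last `k` actions, latest
first (all `n + 1` actions if `n + 1 < k`). -/
def lastActions (k n : ℕ) (x : (i : Finset.Iic n) → State N × Fin N) : List (Fin N) :=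
  List.ofFn fun j : Fin (min k (n + 1)) =>
    (x ⟨n - j, Finset.mem_Iic.2 (Nat.sub_le n j)⟩).2

/-- The law of the state and action at time `n + 1`, given those at times `0, …, n`, when the
policy `π` is fed with the last `k` actions. -/
noncomputable def System.stepKernel (Q : System N M) (k : ℕ) (π : MemoryPolicy N) (n : ℕ) :
    Kernel ((i : Finset.Iic n) → State N × Fin N) (State N × Fin N) :=
  Kernel.ofFunOfCountable fun x =>
    ((Q.nextState (x ⟨n, Finset.mem_Iic.2 le_rfl⟩).1 (x ⟨n, Finset.mem_Iic.2 le_rfl⟩).2).bind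
      fun s => (π s (lastActions k n x)).map fun a => (s, a)).toMeasure

instance (Q : System N M) (k : ℕ) (π : MemoryPolicy N) (n : ℕ) :
    IsMarkovKernel (Q.stepKernel k π n) :=
  ⟨fun _ => PMF.toMeasure.isProbabilityMeasure _⟩

/-- The law of the trajectory `(S₀, A₀), (S₁, A₁), …` when `S₀ ∼ β` and the actions are chosen
by `π`, fed with the current state and the last `k` actions; the memory is empty at time `0`. -/
noncomputable def System.law (Q : System N M) (k : ℕ) (π : MemoryPolicy N) (β : PMF (State N)) :
    Measure (ℕ → State N × Fin N) :=
  Kernel.trajMeasure (X := fun _ => State N × Fin N)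
    (β.bind fun s => (π s []).map fun a => (s, a)).toMeasure (Q.stepKernel k π)

/-- The queues open to JSED-`k` when the remembered actions are `m`: the unconstrained queues, and
the constrained queues that occur at most `k * θ i` times in `m`. -/
def System.Eligible (Q : System N M) (k : ℕ) (m : List (Fin N)) (i : Fin N) : Prop :=
  (i : ℕ) < M → (m.count i : ℝ) ≤ k * Q.θ i

/-- `π` is a JSED-`k` policy: with at most `k` remembered actions, it picks an eligible queue with
the smallest expected delay `s i / μ i` among the eligible queues. Ties may be broken in any way,
also at random; nothing is required where no queue is eligible. -/
def System.IsJSED (Q : System N M) (k : ℕ) (π : MemoryPolicy N) : Prop :=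
  ∀ (s : State N) (m : List (Fin N)), m.length ≤ k → (∃ i, Q.Eligible k m i) →
    ∀ a ∈ (π s m).support, Q.Eligible k m a ∧
      ∀ i, Q.Eligible k m i → (s a : ℝ) / Q.μ a ≤ (s i : ℝ) / Q.μ i

/-- The instantaneous cost of an access to queue `j`. -/
def accessCost (j : Fin N) (_s : State N) (i : Fin N) : ℝ := if j = i then 1 else 0

/-- The long-run frequency of the accesses to queue `i` along a trajectory. -/
noncomputable def accessFrequency (i : Fin N) (x : ℕ → State N × Fin N) : ℝ :=
  limsup (fun T : ℕ => (1 / (T : ℝ)) *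
    ∑ t ∈ Finset.range (T + 1), accessCost i (x t).1 (x t).2) atTop

/-- The average cost `K i` of the policy `π` with memory size `k`: the expected long-run frequency
of the accesses to queue `i`. -/
noncomputable def System.averageCost (Q : System N M) (k : ℕ) (π : MemoryPolicy N)
    (β : PMF (State N)) (i : Fin N) : ℝ :=
  ∫ x, accessFrequency i x ∂(Q.law k π β)

end LoadBalancing

namespace LoadBalancing

variable {N M : ℕ}

/-! The bound is pathwise and does not depend on the service dynamics or on which eligible queue is
chosen. Consider the last access to a constrained queue `i` in a window of `k` consecutive times:
eligibility allows at most `k * θ i` accesses to `i` among the `k` actions before it, so the window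
holds at most `k * θ i + 1` (`sum_window_le`). Cutting time into blocks of length `k` gives
frequency at most `θ i + 1 / k` (`eventually_average_le`), so any `k > 1 / ε` works. Feasibility
ensures that an eligible queue always exists, hence that accesses are a.s. eligible (`ae_eligible`),
and that `0 ≤ θ i`. -/

/-- When the constraints can be met, some queue is eligible whatever the remembered actions. -/
theorem System.Feasible.exists_eligible {Q : System N M} (hQ : Q.Feasible) {k : ℕ}
    {m : List (Fin N)} (hm : m.length ≤ k) : ∃ i, Q.Eligible k m i := by
  obtain ⟨p, -, hp1, hpθ⟩ := hQ
  by_contra! h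
  simp only [System.Eligible, Classical.not_imp, not_le] at h
  have hne : (Finset.univ : Finset (Fin N)).Nonempty := by
    by_contra hne
    rw [Finset.not_nonempty_iff_eq_empty] at hne
    simp [hne] at hp1
  -- If no queue is eligible, all are constrained and each count exceeds `k * θ i ≥ k * p i`;
  -- summing, the memory is longer than `k`.
  have hlt : ∑ i, (k : ℝ) * p i < ∑ i, (m.count i : ℝ) :=
    Finset.sum_lt_sum_of_nonempty hne fun i _ =>
      (mul_le_mul_of_nonneg_left (hpθ i (h i).1) k.cast_nonneg).trans_lt (h i).2
  have hcount : ∑ i, m.count i = m.length := by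
    simpa using Multiset.sum_count_eq_card (s := Finset.univ) (m := (m : Multiset (Fin N)))
      fun _ _ => Finset.mem_univ _
  rw [← Finset.mul_sum, hp1, mul_one, ← Nat.cast_sum, hcount] at hlt
  exact absurd hm (not_le.2 (by exact_mod_cast hlt))

theorem count_ofFn {α : Type*} [DecidableEq α] (a : α) :
    ∀ {n : ℕ} (f : Fin n → α), (List.ofFn f).count a = ∑ j, if f j = a then 1 else 0
  | 0, f => by simp
  | n + 1, f => by
    rw [List.ofFn_succ, List.count_cons, count_ofFn a, Fin.sum_univ_succ, add_comm]
    simp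

theorem length_lastActions (k n : ℕ) (x : (i : Finset.Iic n) → State N × Fin N) :
    (lastActions k n x).length ≤ k := by
  simp [lastActions]

/-- The truncated `n + 1 - k` is `0` for a history shorter than `k`, matching `min k (n + 1)`. -/
theorem count_lastActions (k n : ℕ) (x : ℕ → State N × Fin N) (i : Fin N) :
    (lastActions k n (Preorder.frestrictLe n x)).count i =
      ∑ t ∈ Finset.Ico (n + 1 - k) (n + 1), if (x t).2 = i then 1 else 0 := by
  rw [lastActions, count_ofFn]
  refine (Fin.sum_univ_eq_sum_range (fun j => if (x (n - j)).2 = i then 1 else 0) _).trans ?_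
  refine Finset.sum_nbij' (fun j => n - j) (fun t => n - t) ?_ ?_ ?_ ?_ fun _ _ => rfl
  all_goals simp only [Finset.mem_range, Finset.mem_Ico]; intros; omega

/-- Almost surely, every action after the first is taken by a queue that is eligible. -/
theorem System.IsJSED.ae_eligible {Q : System N M} (hQ : Q.Feasible) {k : ℕ}
    {π : MemoryPolicy N} (hπ : Q.IsJSED k π) (β : PMF (State N)) :
    ∀ᵐ x ∂(Q.law k π β), ∀ n,
      Q.Eligible k (lastActions k n (Preorder.frestrictLe n x)) (x (n + 1)).2 := by
  rw [ae_all_iff]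
  intro n
  have hmap : Measurable fun x : ℕ → State N × Fin N => (Preorder.frestrictLe n x, x (n + 1)) :=
    by fun_prop
  refine ae_of_ae_map (p := fun y : ((i : Finset.Iic n) → State N × Fin N) × (State N × Fin N) =>
    Q.Eligible k (lastActions k n y.1) y.2.2) hmap.aemeasurable ?_
  -- History and next step are jointly distributed as a composition-product, so it suffices to check
  -- the support of the step kernel at each history.
  rw [System.law, ← Kernel.map_frestrictLe_trajMeasure_compProd_eq_map_trajMeasure,
    Measure.ae_compProd_iff (Set.to_countable _).measurableSet]
  refine ae_of_all _ fun y => ?_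
  change PMF.toMeasure _ _ = 0
  rw [PMF.toMeasure_apply_eq_zero_iff _ (Set.to_countable _).measurableSet,
    Set.disjoint_left]
  intro z hz hz'
  simp only [PMF.mem_support_bind_iff, PMF.mem_support_map_iff] at hz
  obtain ⟨s, -, a, ha, rfl⟩ := hz
  exact hz' (hπ s _ (length_lastActions k n y)
    (hQ.exists_eligible (length_lastActions k n y)) a ha).1

/-- If the terms of a `0`-`1` sequence that equal `1` are preceded by at most `c` such terms among
the last `k`, then a window of `k` terms has at most `c + 1` of them. -/
theorem sum_window_le {h : ℕ → ℕ} (h1 : ∀ t, h t ≤ 1) {k : ℕ} {c : ℝ} (hc : 0 ≤ c)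
    (hh : ∀ n, h (n + 1) = 1 → ((∑ t ∈ Finset.Ico (n + 1 - k) (n + 1), h t : ℕ) : ℝ) ≤ c)
    (s : ℕ) : ∀ m ≤ k, ((∑ t ∈ Finset.Ico s (s + m), h t : ℕ) : ℝ) ≤ c + 1
  | 0, _ => by simp; linarith
  | m + 1, hm => by
    rw [← add_assoc, Finset.sum_Ico_succ_top (Nat.le_add_right s m)]
    rcases Nat.le_one_iff_eq_zero_or_eq_one.1 (h1 (s + m)) with h0 | h0
    · rw [h0, add_zero]
      exact sum_window_le h1 hc hh s m (by omega)
    · rw [h0, Nat.cast_add, Nat.cast_one]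
      gcongr
      -- `hh` says nothing about time `0`, but nothing precedes it, so `0 ≤ c` suffices.
      rcases Nat.eq_zero_or_eq_succ_pred (s + m) with hn | hn
      · simpa [hn] using hc
      · rw [hn] at h0 ⊢
        refine le_trans ?_ (hh _ h0)
        gcongr
        omega

theorem sum_range_mul_le {h : ℕ → ℕ} {k : ℕ} {c : ℝ}
    (hw : ∀ s, ((∑ t ∈ Finset.Ico s (s + k), h t : ℕ) : ℝ) ≤ c) :
    ∀ q : ℕ, ((∑ t ∈ Finset.range (q * k), h t : ℕ) : ℝ) ≤ q * c
  | 0 => by simp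
  | q + 1 => by
    rw [add_mul, one_mul, Finset.range_eq_Ico,
      ← Finset.sum_Ico_consecutive _ (Nat.zero_le (q * k)) (Nat.le_add_right _ k),
      ← Finset.range_eq_Ico, Nat.cast_add, Nat.cast_add, Nat.cast_one, add_mul, one_mul]
    exact add_le_add (sum_range_mul_le hw q) (hw _)

theorem eventually_average_le {h : ℕ → ℕ} {k : ℕ} (hk : 0 < k) {c b : ℝ} (hcb : c / k < b)
    (hw : ∀ s, ((∑ t ∈ Finset.Ico s (s + k), h t : ℕ) : ℝ) ≤ c) :
    ∀ᶠ T : ℕ in atTop, 1 / (T : ℝ) * (∑ t ∈ Finset.range (T + 1), h t : ℕ) ≤ b := by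
  have hk' : (0 : ℝ) < k := by exact_mod_cast hk
  have hc : 0 ≤ c := (Nat.cast_nonneg _).trans (hw 0)
  -- The times up to `T` fit in `(T + 1) / k + 1` blocks, each contributing at most `c`; the strict
  -- `hcb` absorbs the `1 / T` remainder.
  have hlim : Tendsto (fun T : ℕ => c / k + (c / k + c) / (T : ℝ)) atTop (nhds (c / k)) := by
    simpa using (tendsto_const_div_atTop_nhds_zero_nat (c / k + c)).const_add (c / k)
  filter_upwards [hlim.eventually_lt_const hcb, eventually_gt_atTop 0] with T hT hT0
  have hT0' : (0 : ℝ) < T := by exact_mod_cast hT0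
  refine le_trans ?_ hT.le
  have hsub : ∑ t ∈ Finset.range (T + 1), h t ≤
      ∑ t ∈ Finset.range (((T + 1) / k + 1) * k), h t := by
    gcongr
    exact (Nat.lt_mul_of_div_lt (Nat.lt_succ_self _) hk).le
  have hdiv : (((T + 1) / k : ℕ) : ℝ) ≤ (T + 1) / k := by
    exact_mod_cast Nat.cast_div_le (α := ℝ) (m := T + 1) (n := k)
  calc 1 / (T : ℝ) * (∑ t ∈ Finset.range (T + 1), h t : ℕ)
      ≤ 1 / (T : ℝ) * ((((T + 1) / k + 1 : ℕ) : ℝ) * c) := by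
        gcongr
        exact le_trans (by exact_mod_cast hsub) (sum_range_mul_le hw _)
    _ ≤ 1 / (T : ℝ) * (((T + 1) / k + 1) * c) := by
        push_cast
        gcongr
    _ = _ := by
        field_simp
        ring

theorem sum_accessCost (i : Fin N) (x : ℕ → State N × Fin N) (n : ℕ) :
    ∑ t ∈ Finset.range n, accessCost i (x t).1 (x t).2 =
      ((∑ t ∈ Finset.range n, if (x t).2 = i then 1 else 0 : ℕ) : ℝ) := by
  simp [accessCost, eq_comm]

/-- This bound and `average_le_two` supply the boundedness without which a real `limsup` takes a
junk value. -/
theorem average_nonneg (i : Fin N) (x : ℕ → State N × Fin N) (T : ℕ) :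
    0 ≤ 1 / (T : ℝ) * ∑ t ∈ Finset.range (T + 1), accessCost i (x t).1 (x t).2 := by
  rw [sum_accessCost]
  positivity

theorem average_le_two (i : Fin N) (x : ℕ → State N × Fin N) (T : ℕ) :
    1 / (T : ℝ) * ∑ t ∈ Finset.range (T + 1), accessCost i (x t).1 (x t).2 ≤ 2 := by
  rcases Nat.eq_zero_or_pos T with rfl | hT
  -- `1 / 0 = 0`. For `T ≥ 1` there are `T + 1` terms over `T`, hence the bound `2` and not `1`.
  · simp
  have hT' : (1 : ℝ) ≤ T := by exact_mod_cast hT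
  have hsum : ∑ t ∈ Finset.range (T + 1), accessCost i (x t).1 (x t).2 ≤ T + 1 := by
    refine (Finset.sum_le_card_nsmul _ _ 1 fun t _ => ?_).trans (by simp)
    unfold accessCost
    split_ifs <;> norm_num
  rw [one_div, inv_mul_le_iff₀ (by linarith)]
  linarith

theorem accessFrequency_le_of_eventually {i : Fin N} {x : ℕ → State N × Fin N} {b : ℝ}
    (hb : ∀ᶠ T : ℕ in atTop,
      1 / (T : ℝ) * ∑ t ∈ Finset.range (T + 1), accessCost i (x t).1 (x t).2 ≤ b) :
    accessFrequency i x ≤ b :=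
  limsup_le_of_le (isCoboundedUnder_le_of_le atTop (average_nonneg i x)) hb

theorem accessFrequency_nonneg (i : Fin N) (x : ℕ → State N × Fin N) :
    0 ≤ accessFrequency i x :=
  le_limsup_of_frequently_le (Frequently.of_forall (average_nonneg i x))
    (isBoundedUnder_of ⟨2, average_le_two i x⟩)

theorem measurable_accessFrequency (i : Fin N) :
    Measurable (accessFrequency i : (ℕ → State N × Fin N) → ℝ) := by
  refine Measurable.limsup fun T => measurable_const.mul (Finset.measurable_sum _ fun t _ => ?_)
  have h : Measurable fun y : State N × Fin N => accessCost i y.1 y.2 := measurable_of_countable _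
  exact h.comp (measurable_pi_apply t)

instance (Q : System N M) (k : ℕ) (π : MemoryPolicy N) (β : PMF (State N)) :
    IsProbabilityMeasure (Q.law k π β) := by
  unfold System.law
  infer_instance

theorem integrable_accessFrequency (Q : System N M) (k : ℕ) (π : MemoryPolicy N)
    (β : PMF (State N)) (i : Fin N) : Integrable (accessFrequency i) (Q.law k π β) := by
  refine Integrable.of_bound (measurable_accessFrequency i).aestronglyMeasurable 2
    (ae_of_all _ fun x => ?_)
  rw [Real.norm_of_nonneg (accessFrequency_nonneg i x)]
  exact accessFrequency_le_of_eventually (Eventually.of_forall (average_le_two i x))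

/-- Along a trajectory that uses eligible queues only, the frequency of the accesses to a
constrained queue exceeds its capacity by at most `1 / k`. -/
theorem accessFrequency_le {Q : System N M} {k : ℕ} (hk : 0 < k) {i : Fin N} (hi : (i : ℕ) < M)
    (hθ : 0 ≤ Q.θ i) {ε : ℝ} (hkε : 1 / (k : ℝ) < ε) {x : ℕ → State N × Fin N}
    (hx : ∀ n, Q.Eligible k (lastActions k n (Preorder.frestrictLe n x)) (x (n + 1)).2) :
    accessFrequency i x ≤ Q.θ i + ε := by
  have hk' : (0 : ℝ) < k := by exact_mod_cast hk
  apply accessFrequency_le_of_eventually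
  simp only [sum_accessCost]
  refine eventually_average_le hk (c := k * Q.θ i + 1) ?_ fun s =>
    sum_window_le (fun t => ?_) (by positivity) (fun n hn => ?_) s k le_rfl
  · rw [add_div, mul_div_cancel_left₀ _ hk'.ne']
    gcongr
  · split_ifs <;> simp
  · have hn : (x (n + 1)).2 = i := by simpa using hn
    have := hx n
    rw [hn] at this
    rw [← count_lastActions]
    exact this hi

end LoadBalancing

theorem mainTheorem2 {N M : ℕ} (Q : LoadBalancing.System N M) (hQ : Q.Feasible)
    (ε : ℝ) (hε : 0 < ε) :
    ∃ k₀ : ℕ, ∀ k : ℕ, k₀ ≤ k →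
      ∀ π : LoadBalancing.MemoryPolicy N, Q.IsJSED k π →
        ∀ (β : PMF (LoadBalancing.State N)) (i : Fin N), (i : ℕ) < M →
          (∀ᵐ x ∂(Q.law k π β), LoadBalancing.accessFrequency i x ≤ Q.θ i + ε) ∧
          MeasureTheory.Integrable (LoadBalancing.accessFrequency i) (Q.law k π β) ∧
          Q.averageCost k π β i ≤ Q.θ i + ε := by
  obtain ⟨n, hn⟩ := exists_nat_one_div_lt hε
  refine ⟨n + 1, fun k hk π hπ β i hi => ?_⟩
  have hkε : 1 / (k : ℝ) < ε := by
    refine lt_of_le_of_lt (one_div_le_one_div_of_le (by positivity) ?_) hn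
    exact_mod_cast hk
  have hθ : 0 ≤ Q.θ i := by
    obtain ⟨p, hp0, -, hpθ⟩ := hQ
    exact (hp0 i).trans (hpθ i hi)
  have hae : ∀ᵐ x ∂(Q.law k π β), LoadBalancing.accessFrequency i x ≤ Q.θ i + ε :=
    (hπ.ae_eligible hQ β).mono fun x hx =>
      LoadBalancing.accessFrequency_le (Nat.succ_pos n |>.trans_le hk) hi hθ hkε hx
  have hint := LoadBalancing.integrable_accessFrequency Q k π β i
  refine ⟨hae, hint, ?_⟩
  calc Q.averageCost k π β i ≤ ∫ _, (Q.θ i + ε) ∂(Q.law k π β) :=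
        integral_mono_ae hint (integrable_const _) hae
    _ = Q.θ i + ε := by simp
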